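/- All Banach spaces are complex. Let $0<\theta\le 1$ and put $p=2/\theta\in[2,\infty)$. A Banach space $Z$ is called strictly $\theta$-Hilbertian if it is isometric to a complex interpolation space $(X_0,X_1)_\theta$, where $(X_0,X_1)$ is a compatible couple consisting of a Banach space $X_0$ and a Hilbert space $X_1$ (continuously and linearly embedded in a common Hausdorff topological vector space). Here $(X_0,X_1)_\theta$ is the set of values $f(\theta)$ of bounded continuous functions $f\colon\{0\le \mathrm{Re}\,z\le 1\}\to X_0+X_1$ which are holomorphic on $\{0<\mathrm{Re}\,z<1\}$ and for which $t\mapsto f(j+it)$ is, for $j=0,1$, a continuous function from $\mathbb R$ to $X_j$ tending to $0$ at infinity; it is normed by $\|x\|=\inf\{\max_{j=0,1}\sup_{t}\|f(j+it)\|_{X_j} : f(\theta)=x\}$. Let $X$ be a Banach space that is linearly isometric to a subquotient (a quotient of a closed subspace by a closed subspace of it, with the quotient norm) of a strictly $\theta$-Hilbertian space. Then for every probability space and every Bochner integrable $X$-valued random variable $U$ on it, \[ \|\mathbb E[U]\|^p + 4^{1-\frac1\theta}\,\mathbb E\big[\|U-\mathbb E[U]\|^p\big] \le \mathbb E\big[\|U\|^p\big],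 \] where the expectations of $p$-th powers of norms are taken in $[0,\infty]$. -/

import Mathlib

open MeasureTheory
open scoped ENNReal ZeroAtInfty

universe u v w u₀ u₁ u₂

noncomputable section

/-- A compatible couple: two complex normed spaces `X₀`, `X₁` with continuous linear
embeddings into the same topological vector space `V`. -/
structure CompatibleCouple (X₀ : Type u₀) (X₁ : Type u₁) (V : Type u₂)
    [NormedAddCommGroup X₀] [NormedSpace ℂ X₀] [NormedAddCommGroup X₁] [NormedSpace ℂ X₁]
    [AddCommGroup V] [Module ℂ V] [TopologicalSpace V] where
  emb₀ : X₀ →L[ℂ] V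
  emb₁ : X₁ →L[ℂ] V
  emb₀_injective : Function.Injective emb₀
  emb₁_injective : Function.Injective emb₁

namespace CompatibleCouple

variable {X₀ : Type u₀} {X₁ : Type u₁} {V : Type u₂}
  [NormedAddCommGroup X₀] [NormedSpace ℂ X₀] [NormedAddCommGroup X₁] [NormedSpace ℂ X₁]
  [AddCommGroup V] [Module ℂ V] [TopologicalSpace V]
  [IsTopologicalAddGroup V] [ContinuousSMul ℂ V] [T2Space V]

/-- The map `(a, b) ↦ a + b` with values in the ambient space. -/
def sumMap (c : CompatibleCouple X₀ X₁ V) : WithLp 1 (X₀ × X₁) →L[ℂ] V :=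
  c.emb₀.comp (WithLp.fstL 1 ℂ X₀ X₁) + c.emb₁.comp (WithLp.sndL 1 ℂ X₀ X₁)

/-- The pairs `(a, b)` with `a + b = 0` in the ambient space. -/
def sumKer (c : CompatibleCouple X₀ X₁ V) : Submodule ℂ (WithLp 1 (X₀ × X₁)) :=
  LinearMap.ker (c.sumMap : WithLp 1 (X₀ × X₁) →ₗ[ℂ] V)

instance (c : CompatibleCouple X₀ X₁ V) :
    IsClosed (c.sumKer : Set (WithLp 1 (X₀ × X₁))) :=
  c.sumMap.isClosed_ker

/-- The space `X₀ + X₁` with the norm `‖x‖ = inf {‖a‖ + ‖b‖ : x = a + b}`, as the quotient of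
the `ℓ¹`-sum of `X₀` and `X₁` by the pairs whose sum vanishes in the ambient space. -/
abbrev SumSpace (c : CompatibleCouple X₀ X₁ V) : Type (max u₀ u₁) :=
  WithLp 1 (X₀ × X₁) ⧸ c.sumKer

/-- The inclusion of `X₀` in `X₀ + X₁`. -/
def incl₀ (c : CompatibleCouple X₀ X₁ V) (a : X₀) : c.SumSpace :=
  c.sumKer.mkQ (WithLp.toLp 1 (a, 0))

/-- The inclusion of `X₁` in `X₀ + X₁`. -/
def incl₁ (c : CompatibleCouple X₀ X₁ V) (b : X₁) : c.SumSpace :=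
  c.sumKer.mkQ (WithLp.toLp 1 (0, b))

/-- The space of functions used in the complex method: bounded continuous functions from the
closed strip `0 ≤ Re z ≤ 1` to `X₀ + X₁` that are holomorphic in the open strip, and for which
`t ↦ f (j + i t)` is, for `j = 0, 1`, a continuous function with values in `X_j` that tends
to zero at infinity. (Values of `toFun` outside the closed strip play no role.) -/
structure StripFunction (c : CompatibleCouple X₀ X₁ V) where
  toFun : ℂ → c.SumSpace
  bdry₀ : C₀(ℝ, X₀)
  bdry₁ : C₀(ℝ, X₁)
  continuousOn : ContinuousOn toFun {z | 0 ≤ z.re ∧ z.re ≤ 1}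
  differentiableOn : DifferentiableOn ℂ toFun {z | 0 < z.re ∧ z.re < 1}
  bounded : ∃ M : ℝ, ∀ z : ℂ, 0 ≤ z.re → z.re ≤ 1 → ‖toFun z‖ ≤ M
  toFun_bdry₀ : ∀ t : ℝ, toFun (t * Complex.I) = c.incl₀ (bdry₀ t)
  toFun_bdry₁ : ∀ t : ℝ, toFun (1 + t * Complex.I) = c.incl₁ (bdry₁ t)

/-- The norm `max (sup_t ‖f (i t)‖_{X₀}) (sup_t ‖f (1 + i t)‖_{X₁})`. -/
def StripFunction.size {c : CompatibleCouple X₀ X₁ V} (f : c.StripFunction) : ℝ :=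
  max ‖f.bdry₀‖ ‖f.bdry₁‖

/-- The complex interpolation space `(X₀, X₁)_θ`, as a linear subspace of `X₀ + X₁`: the values
at `θ` of the functions above. -/
def interpSpace (c : CompatibleCouple X₀ X₁ V) (θ : ℝ) : Submodule ℂ c.SumSpace where
  carrier := {x | ∃ f : c.StripFunction, f.toFun (θ : ℂ) = x}
  zero_mem' := ⟨⟨fun _ => 0, 0, 0, continuousOn_const, differentiableOn_const _,
    ⟨0, fun _ _ _ => by simp⟩, fun _ => (map_zero c.sumKer.mkQ).symm,
    fun _ => (map_zero c.sumKer.mkQ).symm⟩, rfl⟩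
  add_mem' := by
    rintro _ _ ⟨f, rfl⟩ ⟨g, rfl⟩
    refine ⟨⟨fun z => f.toFun z + g.toFun z, f.bdry₀ + g.bdry₀, f.bdry₁ + g.bdry₁,
      f.continuousOn.add g.continuousOn, f.differentiableOn.add g.differentiableOn,
      ?_, fun t => ?_, fun t => ?_⟩, rfl⟩
    · obtain ⟨M, hM⟩ := f.bounded
      obtain ⟨N, hN⟩ := g.bounded
      exact ⟨M + N, fun z h0 h1 => norm_add_le_of_le (hM z h0 h1) (hN z h0 h1)⟩
    · rw [f.toFun_bdry₀, g.toFun_bdry₀, incl₀, incl₀, incl₀, ← map_add, ← WithLp.toLp_add]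
      simp
    · rw [f.toFun_bdry₁, g.toFun_bdry₁, incl₁, incl₁, incl₁, ← map_add, ← WithLp.toLp_add]
      simp
  smul_mem' := by
    rintro a _ ⟨f, rfl⟩
    refine ⟨⟨fun z => a • f.toFun z, a • f.bdry₀, a • f.bdry₁,
      f.continuousOn.const_smul a, f.differentiableOn.const_smul a,
      ?_, fun t => ?_, fun t => ?_⟩, rfl⟩
    · obtain ⟨M, hM⟩ := f.bounded
      refine ⟨‖a‖ * M, fun z h0 h1 => ?_⟩
      rw [norm_smul]
      exact mul_le_mul_of_nonneg_left (hM z h0 h1) (norm_nonneg a)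
    · rw [f.toFun_bdry₀, incl₀, incl₀, ← map_smul, ← WithLp.toLp_smul]
      simp
    · rw [f.toFun_bdry₁, incl₁, incl₁, ← map_smul, ← WithLp.toLp_smul]
      simp

/-- The norm of the complex interpolation space `(X₀, X₁)_θ`: the infimum of the norms of the
functions above that take the value `x` at `θ`. -/
def interpNorm (c : CompatibleCouple X₀ X₁ V) (θ : ℝ) (x : c.SumSpace) : ℝ :=
  sInf {r | ∃ f : c.StripFunction, f.toFun (θ : ℂ) = x ∧ f.size = r}

end CompatibleCouple

/-- `Z` is strictly `θ`-Hilbertian: it is (isometrically) the complex interpolation space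
`(X₀, X₁)_θ` for a compatible couple of a complex Banach space `X₀` and a complex Hilbert
space `X₁`, where `0 < θ ≤ 1`. -/
def IsStrictlyHilbertian (θ : ℝ) (Z : Type v) [NormedAddCommGroup Z] [NormedSpace ℂ Z] : Prop :=
  0 < θ ∧ θ ≤ 1 ∧
  ∃ (X₀ : Type u₀) (_ : NormedAddCommGroup X₀) (_ : NormedSpace ℂ X₀) (_ : CompleteSpace X₀)
    (X₁ : Type u₁) (_ : NormedAddCommGroup X₁) (_ : InnerProductSpace ℂ X₁)
    (_ : CompleteSpace X₁)
    (V : Type u₂) (_ : AddCommGroup V) (_ : Module ℂ V) (_ : TopologicalSpace V)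
    (_ : IsTopologicalAddGroup V) (_ : ContinuousSMul ℂ V) (_ : T2Space V)
    (c : CompatibleCouple X₀ X₁ V) (e : Z ≃ₗ[ℂ] c.interpSpace θ),
    ∀ z : Z, ‖z‖ = c.interpNorm θ (e z : c.SumSpace)

/-- `X` is isometric to a subquotient of `Z`: to a quotient of a closed subspace `S` of `Z` by a
closed subspace `N` of `S`, with the quotient norm. -/
def IsIsometricToSubquotient (X : Type u) [NormedAddCommGroup X] [NormedSpace ℂ X]
    (Z : Type v) [NormedAddCommGroup Z] [NormedSpace ℂ Z] : Prop :=
  ∃ (S : Submodule ℂ Z) (N : Submodule ℂ S),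
    IsClosed (S : Set Z) ∧ IsClosed (N : Set S) ∧ Nonempty (X ≃ₗᵢ[ℂ] S ⧸ N)

end

/-!
For finitely many values the statement is an interpolation of two elementary bounds. Consider the
operator that sends a family `(x k)`, with weights `w k` of sum one and mean `m`, to `m` and the
deviations `(x k - m)`. Over the Hilbert space `X₁`, with `ℓ²` norms, it is an isometry, by the
variance identity. Over the Banach space `X₀`, with `ℓ^∞` norms, the mean has norm at most one and
the deviations have norm at most two, so that the analytic family of operators with the factor
`2^{z-1}` before the deviations is contractive on both sides of the strip
(`CompatibleCouple.interpNorm_mean_rpow_add_le`). At `z = θ` the factor contributes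
`2^{(θ-1)p} = 4^{1-1/θ}`.

What remains is the inclusion `(ℓ^∞(X₀), ℓ²(X₁))_θ ⊆ ℓ^p((X₀, X₁)_θ)` with constant one, which is
`CompatibleCouple.sum_interpNorm_rpow_le`. A strip function `g` with `‖g(it)‖ ≤ 1` is divided by an
outer function `e^ψ` with `Re ψ(it) = 0` and `Re ψ(1+it) ≥ log ‖g(1+it)‖`, which yields
`‖g(θ)‖_θ ≤ e^{Re ψ(θ)}` and leaves a scalar inequality. No Poisson kernel is needed to produce `ψ`:
as `g` vanishes at infinity, `log ‖g(1+it)‖`, cut off from below, is majorized by a periodic function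
that agrees with it on one period, and trigonometric polynomials, which are uniformly dense in the
continuous periodic functions, are boundary values of explicit entire functions
(`IsStripExtension.exists_approx`). The scalar inequality `sum_exp_le_of_isStripExtension` follows
from Jensen's inequality and the maximum principle, applied to a single exponential formed with Gibbs
weights.

The inequality for finitely many values passes to subquotients by lifting the points, and from
simple functions to integrable functions by density in `L^p`.
-/

/-! ### Trigonometric polynomials as boundary values on the strip -/

/-- The entire functions that serve as logarithms of outer functions: their real part vanishes on
`Re z = 0`, is bounded on the strip `0 ≤ Re z ≤ 1`, and is `u` on `Re z = 1`. -/
structure IsStripExtension (ψ : ℂ → ℂ) (u : ℝ → ℝ) : Prop where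
  differentiable : Differentiable ℂ ψ
  bounded : ∃ M : ℝ, ∀ z : ℂ, 0 ≤ z.re → z.re ≤ 1 → |(ψ z).re| ≤ M
  re_left : ∀ t : ℝ, (ψ (t * Complex.I)).re = 0
  re_right : ∀ t : ℝ, (ψ (1 + t * Complex.I)).re = u t

namespace IsStripExtension

lemma add {ψ φ : ℂ → ℂ} {u v : ℝ → ℝ} (hψ : IsStripExtension ψ u) (hφ : IsStripExtension φ v) :
    IsStripExtension (fun z => ψ z + φ z) (fun t => u t + v t) where
  differentiable := hψ.differentiable.add hφ.differentiable
  bounded := by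
    obtain ⟨M, hM⟩ := hψ.bounded
    obtain ⟨N, hN⟩ := hφ.bounded
    refine ⟨M + N, fun z h0 h1 => ?_⟩
    rw [Complex.add_re]
    exact (abs_add_le _ _).trans (add_le_add (hM z h0 h1) (hN z h0 h1))
  re_left t := by simp [hψ.re_left, hφ.re_left]
  re_right t := by simp [hψ.re_right, hφ.re_right]

lemma const (a : ℝ) : IsStripExtension (fun z => a * z) (fun _ => a) where
  differentiable := by fun_prop
  bounded := by
    refine ⟨|a|, fun z h0 h1 => ?_⟩
    simp only [Complex.re_ofReal_mul, abs_mul, abs_of_nonneg h0]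
    exact mul_le_of_le_one_right (abs_nonneg a) h1
  re_left t := by simp
  re_right t := by simp

/-- The function `t ↦ Re (c e^{ist})` is the boundary value of the real part of
`(c e^{sz} - \bar c e^{-sz}) / (e^s - e^{-s})`. -/
lemma exists_cexp (s : ℝ) (c : ℂ) :
    ∃ ψ, IsStripExtension ψ (fun t => (c * Complex.exp (s * t * Complex.I)).re) := by
  rcases eq_or_ne s 0 with rfl | hs
  · exact ⟨_, by simpa using const c.re⟩
  have hd : Real.exp s - Real.exp (-s) ≠ 0 := by
    intro h
    have : s = -s := Real.exp_injective (sub_eq_zero.mp h)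
    exact hs (by linarith)
  set d : ℝ := Real.exp s - Real.exp (-s)
  refine ⟨fun z => ((d⁻¹ : ℝ) : ℂ) *
    (c * Complex.exp (s * z) - (starRingEnd ℂ) c * Complex.exp (-(s * z))), ?_, ?_, ?_, ?_⟩
  · fun_prop
  · refine ⟨|d⁻¹| * (‖c‖ * Real.exp |s| + ‖c‖ * Real.exp |s|), fun z h0 h1 => ?_⟩
    rw [Complex.re_ofReal_mul, abs_mul]
    refine mul_le_mul_of_nonneg_left ((Complex.abs_re_le_norm _).trans
      ((norm_sub_le _ _).trans ?_)) (abs_nonneg _)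
    have hsz : |s * z.re| ≤ |s| := by
      rw [abs_mul, abs_of_nonneg h0]
      exact mul_le_of_le_one_right (abs_nonneg s) h1
    rw [norm_mul, norm_mul, RCLike.norm_conj, Complex.norm_exp, Complex.norm_exp]
    gcongr
    · simpa using (le_abs_self _).trans hsz
    · simpa using (neg_le_abs _).trans hsz
  · intro t
    simp only [Complex.re_ofReal_mul]
    have h : (starRingEnd ℂ) c * Complex.exp (-(s * (t * Complex.I)))
        = (starRingEnd ℂ) (c * Complex.exp (s * (t * Complex.I))) := by
      rw [map_mul, ← Complex.exp_conj]; simp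
    rw [h]; simp
  · intro t
    have h1 : Complex.exp (s * (1 + t * Complex.I))
        = (Real.exp s : ℂ) * Complex.exp (s * t * Complex.I) := by
      rw [Complex.ofReal_exp, ← Complex.exp_add]; ring_nf
    have h2 : Complex.exp (-(s * (1 + t * Complex.I)))
        = (Real.exp (-s) : ℂ) * (starRingEnd ℂ) (Complex.exp (s * t * Complex.I)) := by
      rw [Complex.ofReal_exp, ← Complex.exp_conj, ← Complex.exp_add]
      simp; ring_nf
    rw [h1, h2]
    have h3 : c * ((Real.exp s : ℂ) * Complex.exp (s * t * Complex.I))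
        - (starRingEnd ℂ) c * ((Real.exp (-s) : ℂ)
          * (starRingEnd ℂ) (Complex.exp (s * t * Complex.I)))
        = (Real.exp s : ℂ) * (c * Complex.exp (s * t * Complex.I))
        - (Real.exp (-s) : ℂ) * (starRingEnd ℂ) (c * Complex.exp (s * t * Complex.I)) := by
      rw [map_mul]; ring
    rw [h3, Complex.re_ofReal_mul, Complex.sub_re, Complex.re_ofReal_mul, Complex.re_ofReal_mul,
      Complex.conj_re, ← sub_mul, ← mul_assoc, inv_mul_cancel₀ hd, one_mul]

lemma exists_of_mem_span_fourier {T : ℝ} {p : C(AddCircle T, ℂ)}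
    (hp : p ∈ Submodule.span ℂ (Set.range (@fourier T))) :
    ∃ ψ, IsStripExtension ψ (fun t => (p (t : AddCircle T)).re) := by
  -- multiplication by a complex scalar does not commute with `Re`, hence the factor `c`
  suffices h : ∀ c : ℂ, ∃ ψ, IsStripExtension ψ (fun t => (c * p (t : AddCircle T)).re) by
    simpa using h 1
  induction hp using Submodule.span_induction with
  | mem p hp =>
    obtain ⟨n, rfl⟩ := hp
    intro c
    obtain ⟨ψ, hψ⟩ := exists_cexp (2 * Real.pi * n / T) c
    refine ⟨ψ, ?_⟩
    convert hψ using 5 with t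
    rw [fourier_coe_apply]
    congr 1
    push_cast
    ring
  | zero => intro c; exact ⟨_, by simpa using const 0⟩
  | add p q _ _ hp hq =>
    intro c
    obtain ⟨ψ, hψ⟩ := hp c
    obtain ⟨φ, hφ⟩ := hq c
    exact ⟨_, by simpa [mul_add] using hψ.add hφ⟩
  | smul a p _ hp =>
    intro c
    obtain ⟨ψ, hψ⟩ := hp (c * a)
    exact ⟨ψ, by simpa [mul_assoc] using hψ⟩

/-- A continuous function `h` that equals its minimum `m` outside `[-R, R]` is majorized on the
whole line by boundary values which, up to `δ`, stay below the values of `h` on `[-R, R)`: these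
approximate the periodic function that agrees with `h` on `[-R, R)`. -/
lemma exists_approx {h : ℝ → ℝ} (hc : Continuous h) {m R : ℝ} (hR : 0 < 2 * R)
    (hm : ∀ t, m ≤ h t) (hout : ∀ t, R ≤ |t| → h t = m) {δ : ℝ} (hδ : 0 < δ) :
    ∃ ψ u, IsStripExtension ψ u ∧ ∀ t, h t ≤ u t ∧ u t ≤ h (toIcoMod hR (-R) t) + δ := by
  have hRpos : 0 < R := by linarith
  have : Fact (0 < 2 * R) := ⟨hR⟩
  let H : C(AddCircle (2 * R), ℂ) :=
    ⟨AddCircle.liftIco (2 * R) (-R) (fun t => (h t : ℂ)), AddCircle.liftIco_continuous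
      (by rw [hout (-R) (by rw [abs_neg]; exact le_abs_self R),
        hout (-R + 2 * R) (by ring_nf; exact le_abs_self R)])
      (Complex.continuous_ofReal.comp hc).continuousOn⟩
  have hH : ∀ t : ℝ, H (t : AddCircle (2 * R)) = h (toIcoMod hR (-R) t) := by
    intro t
    have ht : (t : AddCircle (2 * R)) = (toIcoMod hR (-R) t : ℝ) := by
      rw [toIcoMod, AddCircle.coe_sub, AddCircle.coe_zsmul, AddCircle.coe_period, smul_zero,
        sub_zero]
    rw [ht]
    exact AddCircle.liftIco_coe_apply (f := fun t => (h t : ℂ)) (toIcoMod_mem_Ico hR (-R) t)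
  have hle : ∀ t, h t ≤ h (toIcoMod hR (-R) t) := by
    intro t
    by_cases ht : t ∈ Set.Ico (-R) (-R + 2 * R)
    · rw [(toIcoMod_eq_self hR).2 ht]
    · rw [hout t ?_]
      · exact hm _
      · by_contra! hlt
        have := abs_lt.mp hlt
        exact ht ⟨this.1.le, by linarith⟩
  have hmem : H ∈ (Submodule.span ℂ (Set.range (@fourier (2 * R)))).topologicalClosure := by
    rw [span_fourier_closure_eq_top]; trivial
  obtain ⟨p, hp, hpd⟩ := Metric.mem_closure_iff.mp hmem (δ / 2) (by positivity)
  obtain ⟨ψ, hψ⟩ := exists_of_mem_span_fourier hp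
  refine ⟨_, _, hψ.add (const (δ / 2)), fun t => ?_⟩
  have h1 : |h (toIcoMod hR (-R) t) - (p (t : AddCircle (2 * R))).re| ≤ δ / 2 := by
    have h2 : ‖H t - p t‖ ≤ δ / 2 := by
      rw [← dist_eq_norm]
      exact (ContinuousMap.dist_apply_le_dist _).trans hpd.le
    rw [hH] at h2
    simpa using (Complex.abs_re_le_norm _).trans h2
  have h3 := abs_le.mp h1
  exact ⟨by linarith [hle t], by linarith⟩

end IsStripExtension

/-! ### The maximum principle and the scalar interpolation inequality -/

/-- The maximum principle on the strip for bounded functions. -/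
lemma norm_le_of_forall_boundary_le {B : ℂ → ℂ} (hB : Differentiable ℂ B)
    (hb : ∃ M : ℝ, ∀ z : ℂ, 0 ≤ z.re → z.re ≤ 1 → ‖B z‖ ≤ M) {C : ℝ}
    (h0 : ∀ t : ℝ, ‖B (t * Complex.I)‖ ≤ C) (h1 : ∀ t : ℝ, ‖B (1 + t * Complex.I)‖ ≤ C)
    {z : ℂ} (hz0 : 0 ≤ z.re) (hz1 : z.re ≤ 1) : ‖B z‖ ≤ C := by
  obtain ⟨M, hM⟩ := hb
  refine PhragmenLindelof.vertical_strip (a := 0) (b := 1) hB.diffContOnCl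
    ⟨0, by simpa using Real.pi_pos, 0, ?_⟩ (fun z hz => ?_) (fun z hz => ?_) hz0 hz1
  · refine Asymptotics.IsBigO.of_bound M ?_
    refine Filter.eventually_inf_principal.2 (Filter.Eventually.of_forall fun z hz => ?_)
    simpa using hM z hz.1.le hz.2.le
  · have : z = z.im * Complex.I := Complex.ext (by simpa using hz) (by simp)
    rw [this]; exact h0 _
  · have : z = 1 + z.im * Complex.I := Complex.ext (by simpa using hz) (by simp)
    rw [this]; exact h1 _

/-- The scalar form of the interpolation inclusion `(ℓ^∞, ℓ²)_θ ⊆ ℓ^{2/θ}`, for functions without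
zeros. -/
theorem sum_exp_le_of_isStripExtension {ι : Type*} [Fintype ι] {w : ι → ℝ} (hw : ∀ k, 0 ≤ w k)
    {ψ : ι → ℂ → ℂ} {l : ι → ℝ → ℝ} (hψ : ∀ k, IsStripExtension (ψ k) (l k)) {C : ℝ}
    (hC : 0 < C) (hl : ∀ t, ∑ k, w k * Real.exp (2 * l k t) ≤ C) {θ : ℝ} (hθ : 0 < θ)
    (hθ1 : θ ≤ 1) : ∑ k, w k * Real.exp (2 / θ * (ψ k θ).re) ≤ C := by
  -- Gibbs weights `q k`, and slopes `a k` such that `Re (ψ k z - a k z)` vanishes at `θ`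
  set a : ι → ℝ := fun k => (ψ k θ).re / θ with ha
  set S : ℝ := ∑ k, w k * Real.exp (2 / θ * (ψ k θ).re) with hS
  have hSa : S = ∑ k, w k * Real.exp (2 * a k) := by
    rw [hS]; refine Finset.sum_congr rfl fun k _ => ?_
    rw [ha]; ring_nf
  have hS0 : 0 ≤ S := Finset.sum_nonneg fun k _ => mul_nonneg (hw k) (Real.exp_pos _).le
  rcases hS0.eq_or_lt with h0 | hSpos
  · rw [← h0]; exact hC.le
  set q : ι → ℝ := fun k => w k * Real.exp (2 * a k) / S with hq
  have hq0 : ∀ k, 0 ≤ q k := fun k => div_nonneg (mul_nonneg (hw k) (Real.exp_pos _).le) hSpos.le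
  have hq1 : ∑ k, q k = 1 := by
    rw [hq, ← Finset.sum_div, ← hSa, div_self hSpos.ne']
  set b : ℝ := Real.log (S / C) with hb
  set E : ℂ → ℂ := fun z => ∑ k, (q k : ℂ) * (2 * (ψ k z - a k * z)) + b * z with hE
  have hEre : ∀ z, (E z).re = ∑ k, q k * (2 * ((ψ k z).re - a k * z.re)) + b * z.re := by
    intro z
    simp only [hE, Complex.add_re, Complex.re_sum, Complex.re_ofReal_mul]
    congr 1
    refine Finset.sum_congr rfl fun k _ => ?_
    congr 1
    simp
  have hEd : Differentiable ℂ E := by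
    have := fun k => (hψ k).differentiable
    fun_prop
  have key : ‖Complex.exp (E θ)‖ ≤ 1 := by
    refine norm_le_of_forall_boundary_le (B := fun z => Complex.exp (E z)) hEd.cexp ?_
      (fun t => ?_) (fun t => ?_) (by simpa using hθ.le) (by simpa using hθ1)
    · choose M hM using fun k => (hψ k).bounded
      refine ⟨Real.exp (∑ k, q k * (2 * (M k + |a k|)) + |b|), fun z h0 h1 => ?_⟩
      rw [Complex.norm_exp, hEre]
      have haux : ∀ x : ℝ, x * z.re ≤ |x| := fun x =>
        (le_abs_self _).trans (by
          rw [abs_mul, abs_of_nonneg h0]; exact mul_le_of_le_one_right (abs_nonneg x) h1)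
      refine Real.exp_le_exp.2 (add_le_add (Finset.sum_le_sum fun k _ =>
        mul_le_mul_of_nonneg_left ?_ (hq0 k)) (haux b))
      have h2 := haux (-a k)
      rw [abs_neg] at h2
      linarith [(abs_le.mp (hM k z h0 h1)).2]
    · rw [Complex.norm_exp, hEre]
      simp [(hψ _).re_left]
    · rw [Complex.norm_exp, hEre]
      simp only [(hψ _).re_right]
      -- Jensen's inequality for `exp` with the weights `q k`
      have hJ := convexOn_exp.map_sum_le (t := Finset.univ) (w := q)
        (p := fun k => 2 * (l k t - a k)) (fun k _ => hq0 k) hq1 (fun _ _ => trivial)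
      simp only [smul_eq_mul] at hJ
      have hqe : ∑ k, q k * Real.exp (2 * (l k t - a k))
          = (∑ k, w k * Real.exp (2 * l k t)) / S := by
        rw [Finset.sum_div]
        refine Finset.sum_congr rfl fun k _ => ?_
        rw [hq, mul_sub, Real.exp_sub]
        have := (Real.exp_pos (2 * a k)).ne'
        field_simp
      rw [hqe] at hJ
      simp only [Complex.add_re, Complex.one_re, Complex.mul_re, Complex.ofReal_re, Complex.I_re,
        mul_zero, Complex.ofReal_im, Complex.I_im, mul_one, sub_self, add_zero]
      rw [Real.exp_add, hb, Real.exp_log (div_pos hSpos hC)]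
      calc _ ≤ (∑ k, w k * Real.exp (2 * l k t)) / S * (S / C) := by gcongr
        _ = (∑ k, w k * Real.exp (2 * l k t)) / C := div_mul_div_cancel₀ hSpos.ne'
        _ ≤ 1 := (div_le_one hC).2 (hl t)
  rw [Complex.norm_exp, hEre, Real.exp_le_one_iff] at key
  have hz : ∀ k, (ψ k θ).re - a k * θ = 0 := fun k => by rw [ha]; field_simp; simp
  simp only [Complex.ofReal_re, hz, mul_zero, Finset.sum_const_zero, zero_add] at key
  have hb0 : b ≤ 0 := nonpos_of_mul_nonpos_left key hθ
  have := (Real.log_nonpos_iff (div_pos hSpos hC).le).1 hb0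
  exact (div_le_one hC).1 this

/-! ### Operations on strip functions -/

/-- The product of a function vanishing at infinity by a bounded continuous scalar function. -/
noncomputable def ZeroAtInftyContinuousMap.smulBounded {E : Type*} [NormedAddCommGroup E]
    [NormedSpace ℂ E] (φ : ℝ → ℂ) (hφ : Continuous φ) (hb : ∃ M, ∀ t, ‖φ t‖ ≤ M)
    (f : C₀(ℝ, E)) : C₀(ℝ, E) where
  toFun t := φ t • f t
  continuous_toFun := hφ.smul (map_continuous f)
  zero_at_infty' := by
    obtain ⟨M, hM⟩ := hb
    refine squeeze_zero_norm (a := fun t => M * ‖f t‖) (fun t => ?_) ?_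
    · rw [norm_smul]
      exact mul_le_mul_of_nonneg_right (hM t) (norm_nonneg _)
    · simpa using (zero_at_infty f).norm.const_mul M

lemma ZeroAtInftyContinuousMap.norm_le_of_forall {E : Type*} [NormedAddCommGroup E]
    {f : C₀(ℝ, E)} {C : ℝ} (hC : 0 ≤ C) (h : ∀ t, ‖f t‖ ≤ C) : ‖f‖ ≤ C :=
  (BoundedContinuousFunction.norm_le (f := f.toBCF) hC).2 h

lemma ZeroAtInftyContinuousMap.norm_apply_le {E : Type*} [NormedAddCommGroup E]
    (f : C₀(ℝ, E)) (t : ℝ) : ‖f t‖ ≤ ‖f‖ :=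
  f.toBCF.norm_coe_le_norm t

lemma ZeroAtInftyContinuousMap.sum_apply {E ι : Type*} [NormedAddCommGroup E] [Fintype ι]
    (f : ι → C₀(ℝ, E)) (t : ℝ) : (∑ k, f k) t = ∑ k, f k t :=
  map_sum (AddMonoidHom.mk' (fun g : C₀(ℝ, E) => g t) fun _ _ => rfl) f Finset.univ

namespace CompatibleCouple

variable {X₀ : Type u₀} {X₁ : Type u₁} {V : Type u₂}
  [NormedAddCommGroup X₀] [NormedSpace ℂ X₀] [NormedAddCommGroup X₁] [NormedSpace ℂ X₁]
  [AddCommGroup V] [Module ℂ V] [TopologicalSpace V]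
  [IsTopologicalAddGroup V] {c : CompatibleCouple X₀ X₁ V}

lemma incl₀_smul (a : ℂ) (x : X₀) : c.incl₀ (a • x) = a • c.incl₀ x := by
  rw [incl₀, incl₀, ← map_smul, ← WithLp.toLp_smul]; simp

lemma incl₁_smul (a : ℂ) (x : X₁) : c.incl₁ (a • x) = a • c.incl₁ x := by
  rw [incl₁, incl₁, ← map_smul, ← WithLp.toLp_smul]; simp

lemma incl₀_sum {ι : Type*} [Fintype ι] (x : ι → X₀) :
    c.incl₀ (∑ k, x k) = ∑ k, c.incl₀ (x k) :=
  map_sum (AddMonoidHom.mk' c.incl₀ fun a b => by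
    rw [incl₀, incl₀, incl₀, ← map_add, ← WithLp.toLp_add]; simp) x Finset.univ

lemma incl₁_sum {ι : Type*} [Fintype ι] (x : ι → X₁) :
    c.incl₁ (∑ k, x k) = ∑ k, c.incl₁ (x k) :=
  map_sum (AddMonoidHom.mk' c.incl₁ fun a b => by
    rw [incl₁, incl₁, incl₁, ← map_add, ← WithLp.toLp_add]; simp) x Finset.univ

variable [T2Space V]

namespace StripFunction

/-- The product of a strip function by an entire function that is bounded on the strip. -/
noncomputable def smulEntire (φ : ℂ → ℂ) (hφ : Differentiable ℂ φ)
    (hb : ∃ M : ℝ, ∀ z : ℂ, 0 ≤ z.re → z.re ≤ 1 → ‖φ z‖ ≤ M) (f : c.StripFunction) :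
    c.StripFunction where
  toFun z := φ z • f.toFun z
  bdry₀ := f.bdry₀.smulBounded (fun t => φ (t * Complex.I))
    (hφ.continuous.comp (by fun_prop))
    (hb.imp fun M hM t => hM _ (by simp) (by simp))
  bdry₁ := f.bdry₁.smulBounded (fun t => φ (1 + t * Complex.I))
    (hφ.continuous.comp (by fun_prop))
    (hb.imp fun M hM t => hM _ (by simp) (by simp))
  continuousOn := hφ.continuous.continuousOn.smul f.continuousOn
  differentiableOn := hφ.differentiableOn.smul f.differentiableOn
  bounded := by
    obtain ⟨M, hM⟩ := hb
    obtain ⟨N, hN⟩ := f.bounded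
    refine ⟨M * N, fun z h0 h1 => ?_⟩
    rw [norm_smul]
    exact mul_le_mul (hM z h0 h1) (hN z h0 h1) (norm_nonneg _)
      ((norm_nonneg _).trans (hM z h0 h1))
  toFun_bdry₀ t := by rw [f.toFun_bdry₀, ← incl₀_smul]; rfl
  toFun_bdry₁ t := by rw [f.toFun_bdry₁, ← incl₁_smul]; rfl

/-- Linear combinations of strip functions. -/
noncomputable def linearCombination {ι : Type*} [Fintype ι] (a : ι → ℂ)
    (f : ι → c.StripFunction) : c.StripFunction where
  toFun z := ∑ k, a k • (f k).toFun z
  bdry₀ := ∑ k, a k • (f k).bdry₀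
  bdry₁ := ∑ k, a k • (f k).bdry₁
  continuousOn := continuousOn_finsetSum _ fun k _ => (f k).continuousOn.const_smul (a k)
  differentiableOn :=
    DifferentiableOn.fun_sum fun k _ => (f k).differentiableOn.const_smul (a k)
  bounded := by
    choose M hM using fun k => (f k).bounded
    refine ⟨∑ k, ‖a k‖ * M k, fun z h0 h1 => norm_sum_le_of_le _ fun k _ => ?_⟩
    rw [norm_smul]
    exact mul_le_mul_of_nonneg_left (hM k z h0 h1) (norm_nonneg _)
  toFun_bdry₀ t := by
    have : (∑ k, a k • (f k).bdry₀) t = ∑ k, a k • (f k).bdry₀ t := by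
      simp [ZeroAtInftyContinuousMap.sum_apply]
    rw [this, incl₀_sum]
    simp only [incl₀_smul, (f _).toFun_bdry₀]
  toFun_bdry₁ t := by
    have : (∑ k, a k • (f k).bdry₁) t = ∑ k, a k • (f k).bdry₁ t := by
      simp [ZeroAtInftyContinuousMap.sum_apply]
    rw [this, incl₁_sum]
    simp only [incl₁_smul, (f _).toFun_bdry₁]

lemma linearCombination_bdry₀ {ι : Type*} [Fintype ι] (a : ι → ℂ)
    (f : ι → c.StripFunction) (t : ℝ) :
    (linearCombination a f).bdry₀ t = ∑ k, a k • (f k).bdry₀ t := by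
  simp [linearCombination, ZeroAtInftyContinuousMap.sum_apply]

lemma linearCombination_bdry₁ {ι : Type*} [Fintype ι] (a : ι → ℂ)
    (f : ι → c.StripFunction) (t : ℝ) :
    (linearCombination a f).bdry₁ t = ∑ k, a k • (f k).bdry₁ t := by
  simp [linearCombination, ZeroAtInftyContinuousMap.sum_apply]

end StripFunction

lemma interpNorm_nonneg (θ : ℝ) (x : c.SumSpace) : 0 ≤ c.interpNorm θ x :=
  Real.sInf_nonneg (by
    rintro r ⟨f, -, rfl⟩
    exact (norm_nonneg _).trans (le_max_left _ _))

lemma interpNorm_le {θ C : ℝ} (hC : 0 ≤ C) (f : c.StripFunction)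
    (h0 : ∀ t, ‖f.bdry₀ t‖ ≤ C) (h1 : ∀ t, ‖f.bdry₁ t‖ ≤ C) :
    c.interpNorm θ (f.toFun θ) ≤ C := by
  refine le_trans (b := f.size) (csInf_le ⟨0, ?_⟩ ⟨f, rfl, rfl⟩) (max_le
    (ZeroAtInftyContinuousMap.norm_le_of_forall hC h0)
    (ZeroAtInftyContinuousMap.norm_le_of_forall hC h1))
  rintro r ⟨g, -, rfl⟩
  exact (norm_nonneg _).trans (le_max_left _ _)

/-- The infimum that defines the interpolation norm is approached. -/
lemma exists_stripFunction_of_interpNorm_lt {θ r : ℝ} {x : c.SumSpace}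
    (hx : x ∈ c.interpSpace θ) (hr : c.interpNorm θ x < r) :
    ∃ f : c.StripFunction, f.toFun θ = x ∧ (∀ t, ‖f.bdry₀ t‖ ≤ r) ∧ ∀ t, ‖f.bdry₁ t‖ ≤ r := by
  obtain ⟨f₀, hf₀⟩ := hx
  obtain ⟨_, ⟨f, hf, rfl⟩, hlt⟩ := exists_lt_of_csInf_lt (⟨f₀.size, f₀, hf₀, rfl⟩ :
    {r | ∃ f : c.StripFunction, f.toFun (θ : ℂ) = x ∧ f.size = r}.Nonempty) hr
  exact ⟨f, hf,
    fun t => (f.bdry₀.norm_apply_le t).trans ((le_max_left _ _).trans hlt.le),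
    fun t => (f.bdry₁.norm_apply_le t).trans ((le_max_right _ _).trans hlt.le)⟩

/-- Dividing a strip function by an outer function `e^ψ` that dominates it on the boundary. -/
lemma interpNorm_le_exp_of_isStripExtension {θ : ℝ} (g : c.StripFunction)
    (h0 : ∀ t, ‖g.bdry₀ t‖ ≤ 1) {ψ : ℂ → ℂ} {u : ℝ → ℝ} (hψ : IsStripExtension ψ u)
    (h1 : ∀ t, ‖g.bdry₁ t‖ ≤ Real.exp (u t)) :
    c.interpNorm θ (g.toFun θ) ≤ Real.exp (ψ θ).re := by
  have hb : ∃ M : ℝ, ∀ z : ℂ, 0 ≤ z.re → z.re ≤ 1 → ‖Complex.exp (ψ θ - ψ z)‖ ≤ M := by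
    obtain ⟨M, hM⟩ := hψ.bounded
    refine ⟨Real.exp ((ψ θ).re + M), fun z hz0 hz1 => ?_⟩
    rw [Complex.norm_exp, Complex.sub_re]
    exact Real.exp_le_exp.2 (by linarith [(abs_le.mp (hM z hz0 hz1)).1])
  have hd : Differentiable ℂ fun z => Complex.exp (ψ θ - ψ z) :=
    ((differentiable_const _).sub hψ.differentiable).cexp
  have := interpNorm_le (θ := θ) (Real.exp_pos (ψ θ).re).le (g.smulEntire _ hd hb)
    (fun t => ?_) (fun t => ?_)
  · simpa [StripFunction.smulEntire] using this
  · change ‖Complex.exp (ψ θ - ψ (t * Complex.I)) • g.bdry₀ t‖ ≤ _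
    rw [norm_smul, Complex.norm_exp, Complex.sub_re, hψ.re_left, sub_zero]
    exact mul_le_of_le_one_right (Real.exp_pos _).le (h0 t)
  · change ‖Complex.exp (ψ θ - ψ (1 + t * Complex.I)) • g.bdry₁ t‖ ≤ _
    rw [norm_smul, Complex.norm_exp, Complex.sub_re, hψ.re_right, Real.exp_sub, div_mul_eq_mul_div]
    exact (div_le_iff₀ (Real.exp_pos _)).2
      (mul_le_mul_of_nonneg_left (h1 t) (Real.exp_pos _).le)

/-! ### Families with an `ℓ²` bound on the line `Re z = 1` -/

/-- The inclusion `(ℓ^∞(X₀), ℓ²(X₁))_θ ⊆ ℓ^{2/θ}((X₀, X₁)_θ)` with constant one. -/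
theorem sum_interpNorm_rpow_le {ι : Type*} [Fintype ι] {w : ι → ℝ} (hw : ∀ k, 0 ≤ w k)
    (g : ι → c.StripFunction) (h0 : ∀ k t, ‖(g k).bdry₀ t‖ ≤ 1) {C : ℝ}
    (h1 : ∀ t, ∑ k, w k * ‖(g k).bdry₁ t‖ ^ 2 ≤ C) {θ : ℝ} (hθ : 0 < θ) (hθ1 : θ ≤ 1) :
    ∑ k, w k * c.interpNorm θ ((g k).toFun θ) ^ (2 / θ) ≤ C := by
  have hC : 0 ≤ C :=
    (Finset.sum_nonneg fun k _ => mul_nonneg (hw k) (sq_nonneg _)).trans (h1 0)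
  suffices h : ∀ δ : ℝ, 0 < δ → ∑ k, w k * c.interpNorm θ ((g k).toFun θ) ^ (2 / θ)
      ≤ Real.exp δ ^ 2 * (C + δ ^ 2 * (∑ k, w k) + δ) by
    have hlim : Filter.Tendsto
        (fun δ : ℝ => Real.exp δ ^ 2 * (C + δ ^ 2 * (∑ k, w k) + δ))
        (nhdsWithin 0 (Set.Ioi 0)) (nhds C) := by
      refine (Continuous.tendsto' ?_ 0 C ?_).mono_left nhdsWithin_le_nhds
      · fun_prop
      · simp
    exact ge_of_tendsto hlim (eventually_mem_nhdsWithin.mono fun δ hδ => h δ hδ)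
  intro δ hδ
  obtain ⟨R, hR, hout⟩ : ∃ R : ℝ, 0 < 2 * R ∧ ∀ k t, R ≤ |t| → ‖(g k).bdry₁ t‖ ≤ δ := by
    have hev : ∀ᶠ t in Filter.cocompact ℝ, ∀ k, ‖(g k).bdry₁ t‖ ≤ δ := by
      refine Filter.eventually_all.2 fun k => ?_
      have := (zero_at_infty (g k).bdry₁).norm
      rw [norm_zero] at this
      exact this.eventually_le_const hδ
    rw [← Metric.cobounded_eq_cocompact, ← comap_norm_atTop,
      Filter.eventually_comap] at hev
    obtain ⟨R, hR⟩ := Filter.eventually_atTop.1 hev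
    refine ⟨max R 1, by positivity, fun k t ht => hR |t| ((le_max_left _ _).trans ht) t rfl k⟩
  have hmax : ∀ k t, 0 < max ‖(g k).bdry₁ t‖ δ := fun k t => lt_max_of_lt_right hδ
  choose ψ u hψ hu using fun k => IsStripExtension.exists_approx
    (h := fun t => Real.log (max ‖(g k).bdry₁ t‖ δ))
    (Continuous.log ((map_continuous (g k).bdry₁).norm.max continuous_const)
      fun t => (hmax k t).ne') (m := Real.log δ) hR
    (fun t => Real.log_le_log hδ (le_max_right _ _))
    (fun t ht => by rw [max_eq_right (hout k t ht)]) hδ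
  have hC' : 0 < Real.exp δ ^ 2 * (C + δ ^ 2 * (∑ k, w k) + δ) := by
    have := Finset.sum_nonneg fun k (_ : k ∈ Finset.univ) => hw k
    positivity
  refine le_trans (Finset.sum_le_sum fun k _ => mul_le_mul_of_nonneg_left ?_ (hw k))
    (sum_exp_le_of_isStripExtension hw hψ hC' (fun t => ?_) hθ hθ1)
  · rw [mul_comm, Real.exp_mul]
    refine Real.rpow_le_rpow (interpNorm_nonneg _ _) ?_ (by positivity)
    refine interpNorm_le_exp_of_isStripExtension (g k) (h0 k) (hψ k) fun t => ?_
    refine le_trans (le_max_left _ δ) ?_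
    rw [← Real.log_le_iff_le_exp (hmax k t)]
    exact (hu k t).1
  · set s := toIcoMod hR (-R) t
    have hk : ∀ k, Real.exp (2 * u k t)
        ≤ Real.exp δ ^ 2 * (‖(g k).bdry₁ s‖ ^ 2 + δ ^ 2) := by
      intro k
      calc Real.exp (2 * u k t)
          ≤ Real.exp (2 * (Real.log (max ‖(g k).bdry₁ s‖ δ) + δ)) :=
            Real.exp_le_exp.2 (by linarith [(hu k t).2])
        _ = Real.exp δ ^ 2 * max ‖(g k).bdry₁ s‖ δ ^ 2 := by
            rw [← Real.exp_log (hmax k s), Real.log_exp, ← Real.exp_nat_mul, ← Real.exp_nat_mul,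
              ← Real.exp_add]
            congr 1; push_cast; ring
        _ ≤ _ := by
            gcongr
            rcases max_choice ‖(g k).bdry₁ s‖ δ with h | h <;> rw [h] <;>
              nlinarith [sq_nonneg ‖(g k).bdry₁ s‖, sq_nonneg δ]
    calc ∑ k, w k * Real.exp (2 * u k t)
        ≤ ∑ k, w k * (Real.exp δ ^ 2 * (‖(g k).bdry₁ s‖ ^ 2 + δ ^ 2)) :=
          Finset.sum_le_sum fun k _ => mul_le_mul_of_nonneg_left (hk k) (hw k)
      _ = Real.exp δ ^ 2 * (∑ k, w k * ‖(g k).bdry₁ s‖ ^ 2 + δ ^ 2 * ∑ k, w k) := by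
          rw [Finset.mul_sum Finset.univ w, ← Finset.sum_add_distrib, Finset.mul_sum]
          exact Finset.sum_congr rfl fun k _ => by ring
      _ ≤ _ := by
          exact mul_le_mul_of_nonneg_left (by linarith [h1 s]) (by positivity)

end CompatibleCouple

/-! ### The inequality for finitely many values -/

/-- The variance identity in a Hilbert space. -/
lemma norm_sq_mean_add_sum_norm_sq_sub {ι : Type*} [Fintype ι] {H : Type*}
    [NormedAddCommGroup H] [InnerProductSpace ℂ H] {w : ι → ℝ} (hw1 : ∑ k, w k = 1) (v : ι → H) :
    ‖∑ k, (w k : ℂ) • v k‖ ^ 2 + ∑ k, w k * ‖v k - ∑ j, (w j : ℂ) • v j‖ ^ 2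
      = ∑ k, w k * ‖v k‖ ^ 2 := by
  have h0 (y : H) : inner ℂ (∑ k, (w k : ℂ) • v k) y = ∑ k, (w k : ℂ) * inner ℂ (v k) y := by
    simp only [sum_inner, inner_smul_left, Complex.conj_ofReal]
  set m := ∑ k, (w k : ℂ) • v k
  have h1 : ∑ k, w k * (inner ℂ (v k) m).re = ‖m‖ ^ 2 := by
    rw [← inner_self_eq_norm_sq (𝕜 := ℂ) m, h0]
    simp only [RCLike.re_eq_complex_re, Complex.re_sum, Complex.re_ofReal_mul]
  calc _ = ‖m‖ ^ 2 + ∑ k, (w k * ‖v k‖ ^ 2 - 2 * (w k * (inner ℂ (v k) m).re)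
        + w k * ‖m‖ ^ 2) := by
        congr 1
        refine Finset.sum_congr rfl fun k _ => ?_
        rw [norm_sub_sq (𝕜 := ℂ)]
        simp only [RCLike.re_eq_complex_re]
        ring
    _ = _ := by
        rw [Finset.sum_add_distrib, Finset.sum_sub_distrib, ← Finset.mul_sum, h1,
          ← Finset.sum_mul, hw1]
        ring

lemma norm_mean_le_one {ι : Type*} [Fintype ι] {E : Type*} [NormedAddCommGroup E]
    [NormedSpace ℂ E] {w : ι → ℝ} (hw : ∀ k, 0 ≤ w k) (hw1 : ∑ k, w k = 1) {v : ι → E}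
    (hv : ∀ k, ‖v k‖ ≤ 1) : ‖∑ k, (w k : ℂ) • v k‖ ≤ 1 := by
  rw [← hw1]
  refine norm_sum_le_of_le _ fun k _ => ?_
  rw [norm_smul, Complex.norm_real, Real.norm_of_nonneg (hw k)]
  exact mul_le_of_le_one_right (hw k) (hv k)

lemma exists_norm_cexp_affine_le (a b : ℝ) :
    ∃ M : ℝ, ∀ z : ℂ, 0 ≤ z.re → z.re ≤ 1 → ‖Complex.exp (a * z + b)‖ ≤ M := by
  refine ⟨Real.exp (|a| + b), fun z h0 h1 => ?_⟩
  rw [Complex.norm_exp, Complex.add_re, Complex.re_ofReal_mul, Complex.ofReal_re]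
  refine Real.exp_le_exp.2 (add_le_add_left ((le_abs_self _).trans ?_) _)
  rw [abs_mul, abs_of_nonneg h0]
  exact mul_le_of_le_one_right (abs_nonneg a) h1

namespace CompatibleCouple

variable {X₀ : Type u₀} {X₁ : Type u₁} {V : Type u₂}
  [NormedAddCommGroup X₀] [NormedSpace ℂ X₀] [AddCommGroup V] [Module ℂ V] [TopologicalSpace V]
  [IsTopologicalAddGroup V] [T2Space V]

namespace StripFunction

/-- The product of a strip function by `e^{az+b}`. -/
noncomputable def smulExp [NormedAddCommGroup X₁] [NormedSpace ℂ X₁]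
    {c : CompatibleCouple X₀ X₁ V} (a b : ℝ) (f : c.StripFunction) : c.StripFunction :=
  f.smulEntire (fun z => Complex.exp (a * z + b)) (by fun_prop) (exists_norm_cexp_affine_le a b)

variable [NormedAddCommGroup X₁] [NormedSpace ℂ X₁] {c : CompatibleCouple X₀ X₁ V}

lemma smulExp_toFun (a b s : ℝ) (f : c.StripFunction) :
    (f.smulExp a b).toFun s = (Real.exp (a * s + b) : ℂ) • f.toFun s := by
  simp [smulExp, smulEntire]

lemma norm_smulExp_bdry₀ (a b t : ℝ) (f : c.StripFunction) :
    ‖(f.smulExp a b).bdry₀ t‖ = Real.exp b * ‖f.bdry₀ t‖ := by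
  change ‖Complex.exp (a * (t * Complex.I) + b) • f.bdry₀ t‖ = _
  rw [norm_smul, Complex.norm_exp]
  simp

lemma norm_smulExp_bdry₁ (a b t : ℝ) (f : c.StripFunction) :
    ‖(f.smulExp a b).bdry₁ t‖ = Real.exp (a + b) * ‖f.bdry₁ t‖ := by
  change ‖Complex.exp (a * (1 + t * Complex.I) + b) • f.bdry₁ t‖ = _
  rw [norm_smul, Complex.norm_exp]
  simp

end StripFunction

variable [NormedAddCommGroup X₁] [InnerProductSpace ℂ X₁] {c : CompatibleCouple X₀ X₁ V}

/-- For a family of strip functions that is bounded by one in `ℓ^∞(X₀)` on `Re z = 0` and in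
`ℓ²(w; X₁)` on `Re z = 1`, the mean and the deviations from the mean, the latter damped by
`2^{z-1}`, are bounded by one in the same sense: the constants are `1`, `2` over `X₀`, by the
triangle inequality, and `1`, `1` over `X₁`, by the variance identity. -/
lemma interpNorm_mean_rpow_add_le {ι : Type*} [Fintype ι] {w : ι → ℝ} (hw : ∀ k, 0 ≤ w k)
    (hw1 : ∑ k, w k = 1) (F : ι → c.StripFunction) (h0 : ∀ k t, ‖(F k).bdry₀ t‖ ≤ 1)
    (h1 : ∀ t, ∑ k, w k * ‖(F k).bdry₁ t‖ ^ 2 ≤ 1) {θ : ℝ} (hθ : 0 < θ) (hθ1 : θ ≤ 1) :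
    c.interpNorm θ (∑ k, (w k : ℂ) • (F k).toFun θ) ^ (2 / θ)
      + ∑ k, w k * c.interpNorm θ ((Real.exp (Real.log 2 * (θ - 1)) : ℂ) •
        ((F k).toFun θ - ∑ j, (w j : ℂ) • (F j).toFun θ)) ^ (2 / θ) ≤ 1 := by
  classical
  let D : ι → c.StripFunction := fun k => StripFunction.linearCombination
    (fun j => (if j = k then 1 else 0) - (w j : ℂ)) F
  have hD0 : ∀ k t, (D k).bdry₀ t = (F k).bdry₀ t - ∑ j, (w j : ℂ) • (F j).bdry₀ t := by
    intro k t
    rw [StripFunction.linearCombination_bdry₀]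
    simp [sub_smul, ite_smul]
  have hD1 : ∀ k t, (D k).bdry₁ t = (F k).bdry₁ t - ∑ j, (w j : ℂ) • (F j).bdry₁ t := by
    intro k t
    rw [StripFunction.linearCombination_bdry₁]
    simp [sub_smul, ite_smul]
  have hDθ : ∀ k, (D k).toFun θ = (F k).toFun θ - ∑ j, (w j : ℂ) • (F j).toFun θ := by
    intro k
    simp [D, StripFunction.linearCombination, sub_smul, ite_smul]
  let G : Option ι → c.StripFunction := fun o => o.elim
    (StripFunction.linearCombination (fun j => (w j : ℂ)) F)
    (fun k => (D k).smulExp (Real.log 2) (-Real.log 2))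
  have key := sum_interpNorm_rpow_le (w := fun o : Option ι => o.elim 1 w)
    (fun o => by cases o <;> simp [hw]) G (fun o t => ?_) (C := 1) (fun t => ?_) hθ hθ1
  · rw [Fintype.sum_option] at key
    have hexp : Real.log 2 * θ + -Real.log 2 = Real.log 2 * (θ - 1) := by ring
    simp only [G, Option.elim, StripFunction.smulExp_toFun, hDθ, one_mul, hexp] at key
    exact key
  · cases o with
    | none =>
      simp only [G, Option.elim, StripFunction.linearCombination_bdry₀]
      exact norm_mean_le_one hw hw1 fun k => h0 k t
    | some k =>
      simp only [G, Option.elim, StripFunction.norm_smulExp_bdry₀, hD0]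
      rw [Real.exp_neg, Real.exp_log two_pos]
      have := (norm_sub_le ((F k).bdry₀ t) (∑ j, (w j : ℂ) • (F j).bdry₀ t)).trans
        (add_le_add (h0 k t) (norm_mean_le_one hw hw1 fun k => h0 k t))
      linarith
  · rw [Fintype.sum_option]
    simp only [G, Option.elim, StripFunction.norm_smulExp_bdry₁, hD1, one_mul,
      StripFunction.linearCombination_bdry₁, add_neg_cancel, Real.exp_zero]
    exact (norm_sq_mean_add_sum_norm_sq_sub hw1 _).trans_le (h1 t)

/-- The inequality for finitely many points of an interpolation space; `r k` majorizes the norm of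
`x k` strictly, so that the infimum in the interpolation norm need not be attained. -/
theorem norm_mean_rpow_add_le {Z : Type v} [NormedAddCommGroup Z] [NormedSpace ℂ Z] {θ : ℝ}
    (hθ : 0 < θ) (hθ1 : θ ≤ 1) (e : Z →ₗ[ℂ] c.interpSpace θ)
    (he : ∀ z, ‖z‖ = c.interpNorm θ (e z : c.SumSpace)) {ι : Type*} [Fintype ι] {w : ι → ℝ}
    (hw : ∀ k, 0 ≤ w k) (hw1 : ∑ k, w k = 1) (x : ι → Z) (r : ι → ℝ) (hr : ∀ k, ‖x k‖ < r k) :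
    ‖∑ k, (w k : ℂ) • x k‖ ^ (2 / θ)
      + 4 ^ (1 - 1 / θ) * ∑ k, w k * ‖x k - ∑ j, (w j : ℂ) • x j‖ ^ (2 / θ)
      ≤ ∑ k, w k * r k ^ (2 / θ) := by
  have hr0 : ∀ k, 0 < r k := fun k => (norm_nonneg _).trans_lt (hr k)
  set S := ∑ k, w k * r k ^ (2 / θ) with hS
  have hSpos : 0 < S := by
    refine Finset.sum_pos' (fun k _ => mul_nonneg (hw k) (Real.rpow_nonneg (hr0 k).le _)) ?_
    by_contra! h
    have : ∑ k, w k ≤ 0 := Finset.sum_nonpos fun k hk => by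
      by_contra! hk'
      exact (h k hk).not_gt (mul_pos hk' (Real.rpow_pos_of_pos (hr0 k) _))
    linarith
  choose f hfθ hf0 hf1 using fun k =>
    exists_stripFunction_of_interpNorm_lt (e (x k)).2 ((he (x k)).symm.trans_lt (hr k))
  -- the factor `e^{ρ z} / r` is `1 / r` in modulus on `Re z = 0`, and turns the bound `r` on
  -- `Re z = 1` into `(r ^ (2 / θ) / S) ^ (1 / 2)`; at `θ` it does not depend on `k`
  set ρ : ι → ℝ := fun k => Real.log (r k ^ (2 / θ) / S) / 2 with hρ
  set l : ℝ := Real.exp (-(θ / 2 * Real.log S)) with hl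
  have hlp : l ^ (2 / θ) = S⁻¹ := by
    rw [hl, ← Real.exp_mul, ← Real.exp_log hSpos, ← Real.exp_neg, Real.log_exp]
    congr 1; field_simp
  let F : ι → c.StripFunction := fun k => (f k).smulExp (ρ k) (-Real.log (r k))
  have hFθ : ∀ k, (F k).toFun θ = ((e ((l : ℂ) • x k) : c.interpSpace θ) : c.SumSpace) := by
    intro k
    rw [StripFunction.smulExp_toFun, hfθ, map_smul, Submodule.coe_smul, hl]
    congr 4
    simp only [hρ]
    rw [Real.log_div (Real.rpow_pos_of_pos (hr0 k) _).ne' hSpos.ne',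
      Real.log_rpow (hr0 k)]
    field_simp
    ring
  have key := interpNorm_mean_rpow_add_le hw hw1 F (fun k t => ?_) (fun t => ?_) hθ hθ1
  · set m := ∑ j, (w j : ℂ) • x j with hm
    have hmean : ∑ k, (w k : ℂ) • (F k).toFun θ = (e ((l : ℂ) • m) : c.interpSpace θ) := by
      simp only [hFθ, hm, Finset.smul_sum, map_sum, map_smul, Submodule.coe_smul,
        AddSubmonoidClass.coe_finsetSum]
      exact Finset.sum_congr rfl fun k _ => smul_comm _ _ _
    have hdev : ∀ k, (Real.exp (Real.log 2 * (θ - 1)) : ℂ) •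
        ((F k).toFun θ - (e ((l : ℂ) • m) : c.interpSpace θ)) =
        (e ((Real.exp (Real.log 2 * (θ - 1)) : ℂ) • (l : ℂ) • (x k - m)) : c.interpSpace θ) := by
      intro k
      simp only [hFθ, map_smul, map_sub, Submodule.coe_smul, Submodule.coe_sub, smul_sub]
    have h4 : Real.exp (Real.log 2 * (θ - 1)) ^ (2 / θ) = 4 ^ (1 - 1 / θ) := by
      rw [show (4 : ℝ) = 2 ^ (2 : ℝ) by norm_num, ← Real.rpow_mul two_pos.le,
        Real.rpow_def_of_pos two_pos, ← Real.exp_mul]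
      congr 1; field_simp
    simp only [hmean, hdev, ← he, norm_smul, Complex.norm_real,
      Real.norm_of_nonneg (Real.exp_pos _).le] at key
    have hl0 : 0 ≤ l := (Real.exp_pos _).le
    rw [Real.norm_of_nonneg hl0, Real.mul_rpow hl0 (norm_nonneg _), hlp] at key
    have hterm : ∀ k, w k * (Real.exp (Real.log 2 * (θ - 1)) * (l * ‖x k - m‖)) ^ (2 / θ)
        = S⁻¹ * (4 ^ (1 - 1 / θ) * (w k * ‖x k - m‖ ^ (2 / θ))) := by
      intro k
      rw [Real.mul_rpow (Real.exp_pos _).le (by positivity), Real.mul_rpow hl0 (norm_nonneg _),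
        hlp, h4]
      ring
    simp only [hterm] at key
    rw [← Finset.mul_sum, ← Finset.mul_sum, ← mul_add, inv_mul_le_iff₀ hSpos, mul_one] at key
    exact key
  · rw [StripFunction.norm_smulExp_bdry₀, Real.exp_neg, Real.exp_log (hr0 k),
      inv_mul_le_iff₀ (hr0 k), mul_one]
    exact hf0 k t
  · calc ∑ k, w k * ‖(F k).bdry₁ t‖ ^ 2
        ≤ ∑ k, w k * (r k ^ (2 / θ) / S) := by
          refine Finset.sum_le_sum fun k _ => mul_le_mul_of_nonneg_left ?_ (hw k)
          have hpos : 0 < r k ^ (2 / θ) / S := div_pos (Real.rpow_pos_of_pos (hr0 k) _) hSpos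
          have hle : ‖(F k).bdry₁ t‖ ≤ Real.exp (ρ k) := by
            rw [StripFunction.norm_smulExp_bdry₁, Real.exp_add, Real.exp_neg,
              Real.exp_log (hr0 k), mul_assoc]
            exact mul_le_of_le_one_right (Real.exp_pos _).le
              ((inv_mul_le_iff₀ (hr0 k)).2 (by simpa using hf1 k t))
          calc _ ≤ Real.exp (ρ k) ^ 2 := by gcongr
            _ = _ := by
              rw [← Real.exp_nat_mul, hρ]
              push_cast
              rw [mul_div_cancel₀ _ two_ne_zero, Real.exp_log hpos]
      _ = 1 := by
          simp only [← mul_div_assoc]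
          rw [← Finset.sum_div, ← hS, div_self hSpos.ne']

end CompatibleCouple

/-- The inequality for finitely many points of a subquotient, obtained by lifting them with an
arbitrarily small increase of the norms. -/
theorem IsIsometricToSubquotient.norm_mean_rpow_add_le {X : Type u} [NormedAddCommGroup X]
    [NormedSpace ℂ X] {Z : Type v} [NormedAddCommGroup Z] [NormedSpace ℂ Z] {θ : ℝ}
    (hZ : IsStrictlyHilbertian.{v, u₀, u₁, u₂} θ Z) (hX : IsIsometricToSubquotient X Z)
    {ι : Type*} [Fintype ι] {w : ι → ℝ} (hw : ∀ k, 0 ≤ w k) (hw1 : ∑ k, w k = 1) (x : ι → X) :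
    ‖∑ k, (w k : ℂ) • x k‖ ^ (2 / θ)
      + 4 ^ (1 - 1 / θ) * ∑ k, w k * ‖x k - ∑ j, (w j : ℂ) • x j‖ ^ (2 / θ)
      ≤ ∑ k, w k * ‖x k‖ ^ (2 / θ) := by
  obtain ⟨hθ, hθ1, X₀, _, _, _, X₁, _, _, _, V, _, _, _, _, _, _, c, e, he⟩ := hZ
  obtain ⟨S, N, -, hN, ⟨φ⟩⟩ := hX
  have hp : 0 ≤ 2 / θ := by positivity
  suffices h : ∀ ε : ℝ, 0 < ε → ‖∑ k, (w k : ℂ) • x k‖ ^ (2 / θ)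
      + 4 ^ (1 - 1 / θ) * ∑ k, w k * ‖x k - ∑ j, (w j : ℂ) • x j‖ ^ (2 / θ)
      ≤ ∑ k, w k * (‖x k‖ + ε) ^ (2 / θ) by
    have hlim : Filter.Tendsto (fun ε : ℝ => ∑ k, w k * (‖x k‖ + ε) ^ (2 / θ))
        (nhdsWithin 0 (Set.Ioi 0)) (nhds (∑ k, w k * ‖x k‖ ^ (2 / θ))) := by
      refine (Continuous.tendsto' ?_ 0 _ (by simp)).mono_left nhdsWithin_le_nhds
      exact continuous_finsetSum _ fun k _ => continuous_const.mul
        ((continuous_const.add continuous_id).rpow_const fun _ => Or.inr hp)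
    exact ge_of_tendsto hlim (eventually_mem_nhdsWithin.mono fun ε hε => h ε hε)
  intro ε hε
  have hlift : ∀ k, ∃ s : S, N.mkQ s = φ (x k) ∧ ‖(s : Z)‖ < ‖x k‖ + ε := by
    intro k
    obtain ⟨s, hs, hs'⟩ := Submodule.Quotient.norm_mk_lt (φ (x k)) hε
    exact ⟨s, hs, by rwa [φ.norm_map] at hs'⟩
  choose s hs hsn using hlift
  have hle : ∀ (t : S) (y : X), N.mkQ t = φ y → ‖y‖ ≤ ‖(t : Z)‖ := by
    intro t y h
    rw [← φ.norm_map, ← h]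
    exact Submodule.Quotient.norm_mk_le N t
  have hm : N.mkQ (∑ j, (w j : ℂ) • s j) = φ (∑ j, (w j : ℂ) • x j) := by
    simp only [map_sum, map_smul, hs]
  refine le_trans ?_ (CompatibleCouple.norm_mean_rpow_add_le hθ hθ1 e.toLinearMap he hw hw1
    (fun k => (s k : Z)) _ hsn)
  have hcoe : ((∑ j, (w j : ℂ) • s j : S) : Z) = ∑ j, (w j : ℂ) • (s j : Z) := by simp
  rw [← hcoe]
  refine add_le_add (Real.rpow_le_rpow (norm_nonneg _) (hle _ _ hm) hp)
    (mul_le_mul_of_nonneg_left (Finset.sum_le_sum fun k _ => mul_le_mul_of_nonneg_left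
      (Real.rpow_le_rpow (norm_nonneg _) ?_ hp) (hw k)) (by positivity))
  rw [← Submodule.coe_sub]
  exact hle _ _ (by rw [map_sub, map_sub, hs, hm])

/-! ### From finitely many values to Bochner integrable functions -/

lemma eLpNorm_ofReal_rpow {E Ω : Type*} [NormedAddCommGroup E] [MeasurableSpace Ω]
    (P : Measure Ω) {p : ℝ} (hp : 0 < p) (f : Ω → E) :
    eLpNorm f (ENNReal.ofReal p) P ^ p = ∫⁻ ω, ‖f ω‖ₑ ^ p ∂P := by
  rw [eLpNorm_eq_lintegral_rpow_enorm_toReal (by simpa using hp) ENNReal.ofReal_ne_top,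
    ENNReal.toReal_ofReal hp.le, ← ENNReal.rpow_mul, one_div, inv_mul_cancel₀ hp.ne',
    ENNReal.rpow_one]

lemma enorm_integral_le_eLpNorm {E Ω : Type*} [NormedAddCommGroup E] [NormedSpace ℝ E]
    [MeasurableSpace Ω] (P : Measure Ω) [IsProbabilityMeasure P] {p : ℝ≥0∞} (hp : 1 ≤ p)
    {f : Ω → E} (hf : AEStronglyMeasurable f P) : ‖∫ ω, f ω ∂P‖ₑ ≤ eLpNorm f p P :=
  (enorm_integral_le_lintegral_enorm f).trans
    (eLpNorm_one_eq_lintegral_enorm.symm.trans_le (eLpNorm_le_eLpNorm_of_exponent_le hp hf))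

/-- An inequality between the `p`-th moments of `U`, of `E[U]` and of `U - E[U]` extends from
simple functions to all integrable functions, since the three quantities are continuous for the
`L^p` norm. -/
theorem moment_inequality_of_simpleFunc {E Ω : Type*} [NormedAddCommGroup E] [NormedSpace ℝ E]
    [MeasurableSpace Ω] (P : Measure Ω) [IsProbabilityMeasure P] {p : ℝ} (hp : 1 ≤ p)
    {a : ℝ≥0∞} (ha : a ≠ ∞)
    (h : ∀ g : SimpleFunc Ω E, ‖∫ ω, g ω ∂P‖ₑ ^ p
      + a * ∫⁻ ω, ‖g ω - ∫ ω', g ω' ∂P‖ₑ ^ p ∂P ≤ ∫⁻ ω, ‖g ω‖ₑ ^ p ∂P)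
    {U : Ω → E} (hU : Integrable U P) :
    ‖∫ ω, U ω ∂P‖ₑ ^ p + a * ∫⁻ ω, ‖U ω - ∫ ω', U ω' ∂P‖ₑ ^ p ∂P ≤ ∫⁻ ω, ‖U ω‖ₑ ^ p ∂P := by
  have hp0 : 0 < p := zero_lt_one.trans_le hp
  set q := ENNReal.ofReal p
  have hq : 1 ≤ q := by rwa [← ENNReal.ofReal_one, ENNReal.ofReal_le_ofReal_iff hp0.le]
  simp only [← eLpNorm_ofReal_rpow P hp0] at h ⊢
  by_cases htop : eLpNorm U q P = ∞
  · rw [htop, ENNReal.top_rpow_of_pos hp0]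
    exact le_top
  have hmem : MemLp U q P := ⟨hU.1, lt_top_iff_ne_top.2 htop⟩
  suffices hd : ∀ d : ℝ≥0∞, d ≠ 0 → (‖∫ ω, U ω ∂P‖ₑ - d) ^ p
      + a * (eLpNorm (fun ω => U ω - ∫ ω', U ω' ∂P) q P - (d + d)) ^ p
      ≤ (eLpNorm U q P + d) ^ p by
    have hlim : Filter.Tendsto (fun n : ℕ => (n : ℝ≥0∞)⁻¹) Filter.atTop (nhds 0) :=
      ENNReal.tendsto_inv_nat_nhds_zero
    have hpow : Continuous fun x : ℝ≥0∞ => x ^ p := ENNReal.continuous_rpow_const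
    have hsub : ∀ (b : ℝ≥0∞) {f : ℕ → ℝ≥0∞}, Filter.Tendsto f Filter.atTop (nhds 0) →
        Filter.Tendsto (fun n => (b - f n) ^ p) Filter.atTop (nhds (b ^ p)) := by
      intro b f hf
      have := ENNReal.Tendsto.sub (tendsto_const_nhds (x := b)) hf (Or.inr ENNReal.zero_ne_top)
      rw [tsub_zero] at this
      exact (hpow.tendsto b).comp this
    have hR : Filter.Tendsto (fun n : ℕ => (eLpNorm U q P + (n : ℝ≥0∞)⁻¹) ^ p) Filter.atTop
        (nhds (eLpNorm U q P ^ p)) := by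
      have := hlim.const_add (eLpNorm U q P)
      rw [add_zero] at this
      exact (hpow.tendsto _).comp this
    have hlim2 := hlim.add hlim
    rw [add_zero] at hlim2
    exact le_of_tendsto_of_tendsto' ((hsub _ hlim).add
      (ENNReal.Tendsto.const_mul (hsub _ hlim2) (Or.inr ha))) hR fun n => hd _ (by simp)
  intro d hd
  obtain ⟨g, hg, hgmem⟩ := hmem.exists_simpleFunc_eLpNorm_sub_lt ENNReal.ofReal_ne_top hd
  have hgi : Integrable g P := hgmem.integrable hq
  have hsm : AEStronglyMeasurable (U - ⇑g) P := hU.1.sub hgi.1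
  have hint : ‖∫ ω, U ω ∂P - ∫ ω, g ω ∂P‖ₑ ≤ d := by
    rw [← integral_sub hU hgi]
    exact (enorm_integral_le_eLpNorm P hq hsm).trans hg.le
  refine (add_le_add ?_ (mul_le_mul_right ?_ a)).trans ((h g).trans ?_)
  · refine ENNReal.rpow_le_rpow (tsub_le_iff_right.2 ?_) hp0.le
    calc ‖∫ ω, U ω ∂P‖ₑ = ‖∫ ω, g ω ∂P + (∫ ω, U ω ∂P - ∫ ω, g ω ∂P)‖ₑ := by
          rw [add_sub_cancel]
      _ ≤ _ := (enorm_add_le _ _).trans (add_le_add_right hint _)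
  · refine ENNReal.rpow_le_rpow (tsub_le_iff_right.2 ?_) hp0.le
    have heq : (fun ω => U ω - ∫ ω', U ω' ∂P) = (fun ω => g ω - ∫ ω', g ω' ∂P)
        + ((U - ⇑g) + fun _ => ∫ ω, g ω ∂P - ∫ ω, U ω ∂P) := by
      ext ω
      simp only [Pi.add_apply, Pi.sub_apply]
      abel
    have hc : AEStronglyMeasurable (fun _ : Ω => ∫ ω, g ω ∂P - ∫ ω, U ω ∂P) P :=
      aestronglyMeasurable_const
    rw [heq]
    refine (eLpNorm_add_le (hgi.1.sub aestronglyMeasurable_const) (hsm.add hc) hq).trans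
      (add_le_add_right ((eLpNorm_add_le hsm hc hq).trans (add_le_add hg.le ?_)) _)
    rw [eLpNorm_const _ (zero_lt_one.trans_le hq).ne' (IsProbabilityMeasure.ne_zero P),
      measure_univ, ENNReal.one_rpow, mul_one, ← enorm_neg, neg_sub]
    exact hint
  · refine ENNReal.rpow_le_rpow ?_ hp0.le
    have heq : ⇑g = U - (U - ⇑g) := by rw [sub_sub_cancel]
    conv_lhs => rw [heq]
    exact (eLpNorm_sub_le hU.1 hsm hq).trans (add_le_add_right hg.le _)

lemma lintegral_ofReal_comp_simpleFunc {E Ω : Type*} [MeasurableSpace Ω] (P : Measure Ω)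
    [IsFiniteMeasure P] (g : SimpleFunc Ω E) {φ : E → ℝ} (hφ : ∀ x, 0 ≤ φ x) :
    ∫⁻ ω, ENNReal.ofReal (φ (g ω)) ∂P
      = ENNReal.ofReal (∑ x : g.range, P.real (g ⁻¹' {x.1}) * φ x) := by
  have h := (g.map fun x => ENNReal.ofReal (φ x)).lintegral_eq_lintegral P
  simp only [SimpleFunc.coe_map, Function.comp_apply] at h
  rw [h, SimpleFunc.map_lintegral, ENNReal.ofReal_sum_of_nonneg fun x _ =>
    mul_nonneg measureReal_nonneg (hφ _),
    ← Finset.sum_coe_sort g.range fun x => ENNReal.ofReal (φ x) * P (g ⁻¹' {x})]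
  refine Finset.sum_congr rfl fun x _ => ?_
  rw [ENNReal.ofReal_mul measureReal_nonneg, ofReal_measureReal, mul_comm]

theorem mainTheorem12
    {X : Type u} [NormedAddCommGroup X] [NormedSpace ℂ X] [CompleteSpace X]
    {Z : Type v} [NormedAddCommGroup Z] [NormedSpace ℂ Z] [CompleteSpace Z]
    (θ : ℝ) (hZ : IsStrictlyHilbertian.{v, u₀, u₁, u₂} θ Z) (hX : IsIsometricToSubquotient X Z)
    {Ω : Type w} [MeasurableSpace Ω] (P : Measure Ω) [IsProbabilityMeasure P]
    (U : Ω → X) (hU : Integrable U P) :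
    ‖∫ ω, U ω ∂P‖ₑ ^ (2 / θ)
        + ENNReal.ofReal ((4 : ℝ) ^ (1 - 1 / θ))
          * ∫⁻ ω, ‖U ω - ∫ ω', U ω' ∂P‖ₑ ^ (2 / θ) ∂P
      ≤ ∫⁻ ω, ‖U ω‖ₑ ^ (2 / θ) ∂P := by
  obtain ⟨hθ, hθ1, -⟩ := id hZ
  have hp0 : 0 < 2 / θ := by positivity
  have hp : 1 ≤ 2 / θ := (one_le_div hθ).2 (by linarith)
  refine moment_inequality_of_simpleFunc P hp ENNReal.ofReal_ne_top (fun g => ?_) hU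
  have hpow : ∀ x : X, ‖x‖ₑ ^ (2 / θ) = ENNReal.ofReal (‖x‖ ^ (2 / θ)) := fun x => by
    rw [← ofReal_norm, ENNReal.ofReal_rpow_of_nonneg (norm_nonneg _) hp0.le]
  have hw1 : ∑ x : g.range, P.real (g ⁻¹' {x.1}) = 1 := by
    have := lintegral_ofReal_comp_simpleFunc P g (φ := fun _ => 1) fun _ => zero_le_one
    simpa using this.symm
  have hint : ∫ ω, g ω ∂P = ∑ x : g.range, ((P.real (g ⁻¹' {x.1}) : ℝ) : ℂ) • (x : X) := by
    rw [SimpleFunc.integral_eq_sum g (SimpleFunc.integrable_of_isFiniteMeasure g),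
      ← Finset.sum_coe_sort g.range fun x => P.real (g ⁻¹' {x}) • x]
    simp only [Complex.coe_smul]
  have hp1 : ∀ x : X, 0 ≤ ‖x‖ ^ (2 / θ) := fun x => by positivity
  simp only [hpow]
  rw [lintegral_ofReal_comp_simpleFunc P g (φ := fun x => ‖x‖ ^ (2 / θ)) hp1,
    lintegral_ofReal_comp_simpleFunc P g (φ := fun x => ‖x - ∫ ω', g ω' ∂P‖ ^ (2 / θ))
      fun _ => hp1 _, ← ENNReal.ofReal_mul (by positivity), ← ENNReal.ofReal_add (hp1 _)
      (mul_nonneg (by positivity) (Finset.sum_nonneg fun x _ =>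
        mul_nonneg measureReal_nonneg (hp1 _))), hint]
  exact ENNReal.ofReal_le_ofReal (hX.norm_mean_rpow_add_le hZ
    (w := fun x : g.range => P.real (g ⁻¹' {x.1})) (fun _ => measureReal_nonneg) hw1
    fun x => (x : X))
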